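/- Let $P$ be the uniform probability distribution on the segment $[0,2]\times\{0\}\subset\mathbb R^2$ (the base $OA$ of the equilateral triangle with vertices $O(0,0)$, $A(2,0)$, $B(1,\sqrt3)$), and let $S=S_1\cup S_2$, where $$S_1=\{(x,y): 0\le x\le 1,\ y=\sqrt3\,x\},\qquad S_2=\{(x,y): 1\le x\le 2,\ y=-\sqrt3\,(x-2)\}$$ are the sides $OB$ and $AB$. For a non-empty finite set $\alpha\subset\mathbb R^2$ put $V(P;\alpha)=\int\min_{a\in\alpha}\|x-a\|^2\,dP(x)$, where $\|\cdot\|$ is the Euclidean norm, and for $n\in\mathbb N$ put $$V_n=\inf\{V(P;\alpha):\alpha\subseteq S,\ 1\le\operatorname{card}(\alpha)\le n\}.$$ An optimal set of $n$-points is a set $\alpha\subseteq S$ with $1\le\operatorname{card}(\alpha)\le n$ and $V(P;\alpha)=V_n$. Let $n\ge 6$, and let $\alpha_n$ be an optimal set of $n$-points with $\operatorname{card}(\alpha_n\cap S_1)=\ell$ and $\operatorname{card}(\alpha_n\cap S_2)=m$, where $\ell,m\ge 3$. Then $$\alpha_n=\{(a_i,\,a_i\sqrt3):1\le i\le\ell\}\cup\{(b_j,\,-(b_j-2)\sqrt3):1\le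 j\le m\},$$ where $a_i=\frac{(2i-1)u}{2}$ and $b_j=2-\frac{(2j-1)v}{2}$ with $$u=\frac{1}{2\left(\frac{(12\ell^2+1)m}{\sqrt{(12\ell^2+1)(12m^2+1)}}+\ell\right)},\qquad v=\frac{1}{2\left(\frac{\ell(12m^2+1)}{\sqrt{(12\ell^2+1)(12m^2+1)}}+m\right)},$$ and $$V_n=\frac{(12\ell^2+1)(12m^2+1)}{12\left(24\ell^2m^2+2\ell m\sqrt{(12\ell^2+1)(12m^2+1)}+\ell^2+m^2\right)}.$$ -/

import Mathlib

open MeasureTheory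

/-- The Euclidean plane. -/
abbrev Plane : Type := EuclideanSpace ℝ (Fin 2)

/-- The distortion error `V(P; α) = ∫ min_{a ∈ α} d(x, a)² dP(x)`. The infimum over `α` is a minimum
for the finite non-empty sets `α` that are considered below. -/
noncomputable def distortion (P : Measure Plane) (α : Set Plane) : ℝ :=
  ∫ x, (⨅ a : α, dist x (a : Plane) ^ 2) ∂P

/-- The `n`th constrained quantization error
`V_n = inf {V(P; α) : α ⊆ S, 1 ≤ card α ≤ n}` of `P` with constraint `S`. -/
noncomputable def constrainedError (P : Measure Plane) (S : Set Plane) (n : ℕ) : ℝ :=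
  sInf {r : ℝ | ∃ α : Set Plane, α ⊆ S ∧ 1 ≤ α.encard ∧ α.encard ≤ n ∧ r = distortion P α}

/-- `α` is an optimal set of `n`-points: a non-empty subset of the constraint `S` with at most `n`
elements which attains the infimum in the `n`th constrained quantization error. -/
def IsOptimalSet (P : Measure Plane) (S : Set Plane) (n : ℕ) (α : Set Plane) : Prop :=
  α ⊆ S ∧ 1 ≤ α.encard ∧ α.encard ≤ n ∧ distortion P α = constrainedError P S n

/-- The uniform probability distribution on the base `[0, 2]`, where a real number `x` is identified
with the point `(x, 0)` of the plane. -/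
noncomputable def baseUniform : Measure Plane :=
  (ProbabilityTheory.cond (volume : Measure ℝ) (Set.Icc 0 2)).map (fun x : ℝ => !₂[x, 0])

/-- The side `OB` of the triangle with vertices `O(0, 0)`, `A(2, 0)`, `B(1, √3)`. -/
def sideOB : Set Plane := {p | 0 ≤ p 0 ∧ p 0 ≤ 1 ∧ p 1 = √3 * p 0}

/-- The side `AB` of the triangle with vertices `O(0, 0)`, `A(2, 0)`, `B(1, √3)`. -/
def sideAB : Set Plane := {p | 1 ≤ p 0 ∧ p 0 ≤ 2 ∧ p 1 = -√3 * (p 0 - 2)}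

/-- The points `(a, a √3)`, which form the line through `O` and `B`. -/
noncomputable def pointOB (a : ℝ) : Plane := !₂[a, a * √3]

/-- The points `(b, -(b - 2) √3)`, which form the line through `A` and `B`. -/
noncomputable def pointAB (b : ℝ) : Plane := !₂[b, -(b - 2) * √3]

/-! Completing the square, the squared distance from `(x, 0)` to `(t / 4, t √3 / 4)` is `3/4 x² +
1/4 (x - t)²`, so each side reduces to quantizing an interval of the real line; side `AB` is the
same after `x ↦ 2 - x`. As the points lie on the sides (`t ≤ 4`), the cost from `OB` minus the cost
from `AB` increases with `x`: one cut `d` separates the part `[0, d]` served by `OB` from the rest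
(`min_cost_eq_split`).

On `[0, d]`, `k` points have error at least `d³ / (12 k²)`, with equality only at the midpoints of
`k` equal cells (`quantization_lower`). The total is thus at least `p² d³ + q² (2 - d)³`, with `p`,
`q` given by `sideCoeff`, and this is least exactly when `p d = q (2 - d)` (`min_cost_rigid`).

The midpoint configuration with the same `ℓ` and `m` attains the bound and is admissible, so an
optimal set has equality throughout (`optimal_sidePoints`). The vertex `B`, which would count on
both sides, has to be excluded first. -/

/-- A continuous monotone function on `[0, d]` changes sign at some point of `[0, d]`. -/
lemma exists_sign_change {h : ℝ → ℝ} (hc : Continuous h) {d : ℝ} (hd : 0 ≤ d)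
    (hm : ∀ x y, 0 ≤ x → x ≤ y → y ≤ d → h x ≤ h y) :
    ∃ e, 0 ≤ e ∧ e ≤ d ∧ (∀ x ∈ Set.Ioo 0 e, h x ≤ 0) ∧ (∀ x ∈ Set.Ioo e d, 0 ≤ h x) := by
  rcases le_total 0 (h 0) with h0 | h0
  · exact ⟨0, le_rfl, hd, by simp, fun x hx => h0.trans (hm 0 x le_rfl hx.1.le hx.2.le)⟩
  rcases le_total (h d) 0 with hd' | hd'
  · exact ⟨d, hd, le_rfl, fun x hx => (hm x d hx.1.le hx.2.le le_rfl).trans hd', by simp⟩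
  obtain ⟨e, he, he0⟩ := intermediate_value_Icc hd hc.continuousOn ⟨h0, hd'⟩
  exact ⟨e, he.1, he.2, fun x hx => he0 ▸ hm x e hx.1.le hx.2.le he.2,
    fun x hx => he0 ▸ hm e x he.1 hx.1.le hx.2.le⟩

/-- The weighted sum of two cubes, compared with its minimum for a given sum of the bases. -/
lemma cubes_sub_min {p q : ℝ} (hp : 0 < p) (hq : 0 < q) (x y : ℝ) :
    p ^ 2 * x ^ 3 + q ^ 2 * y ^ 3 - p ^ 2 * q ^ 2 * (x + y) ^ 3 / (p + q) ^ 2 =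
      (p * x - q * y) ^ 2 * (x * (p ^ 2 + 2 * p * q) + y * (q ^ 2 + 2 * p * q)) / (p + q) ^ 2 := by
  have : p + q ≠ 0 := by positivity
  field_simp
  ring

lemma min_le_cubes {p q x y : ℝ} (hp : 0 < p) (hq : 0 < q) (hx : 0 ≤ x) (hy : 0 ≤ y) :
    p ^ 2 * q ^ 2 * (x + y) ^ 3 / (p + q) ^ 2 ≤ p ^ 2 * x ^ 3 + q ^ 2 * y ^ 3 := by
  rw [← sub_nonneg, cubes_sub_min hp hq]
  positivity

/-- In the factorization of `cubes_sub_min` the factor linear in `x`, `y` vanishes only at `x = y =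
0`, where the conclusion is trivial. -/
lemma mul_eq_mul_of_cubes_le_min {p q x y : ℝ} (hp : 0 < p) (hq : 0 < q) (hx : 0 ≤ x) (hy : 0 ≤ y)
    (h : p ^ 2 * x ^ 3 + q ^ 2 * y ^ 3 ≤ p ^ 2 * q ^ 2 * (x + y) ^ 3 / (p + q) ^ 2) :
    p * x = q * y := by
  have h1 := cubes_sub_min hp hq x y
  by_contra hne
  have h2 : 0 < (p * x - q * y) ^ 2 := by
    have := sub_ne_zero.2 hne
    positivity
  have h3 : 0 < x * (p ^ 2 + 2 * p * q) + y * (q ^ 2 + 2 * p * q) := by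
    rcases hx.eq_or_lt with rfl | hx
    · rcases hy.eq_or_lt with rfl | hy
      · simp at hne
      · positivity
    · positivity
  have h4 : 0 < (p * x - q * y) ^ 2 * (x * (p ^ 2 + 2 * p * q) + y * (q ^ 2 + 2 * p * q)) /
    (p + q) ^ 2 := by positivity
  linarith

/-! ### Quantization of an interval by finitely many reals -/

lemma exists_abs_eq_infDist {T : Finset ℝ} (hT : T.Nonempty) (x : ℝ) :
    ∃ t ∈ T, Metric.infDist x (T : Set ℝ) ^ 2 = (x - t) ^ 2 := by
  obtain ⟨t, ht, h⟩ := T.finite_toSet.isCompact.exists_infDist_eq_dist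
    (Finset.coe_nonempty.2 hT) x
  exact ⟨t, ht, by rw [h, Real.dist_eq, sq_abs]⟩

lemma sq_infDist_le {T : Set ℝ} {t : ℝ} (ht : t ∈ T) (x : ℝ) :
    Metric.infDist x T ^ 2 ≤ (x - t) ^ 2 := by
  have := Metric.infDist_le_dist_of_mem (x := x) ht
  rw [← sq_abs (x - t), ← Real.dist_eq]
  have := Metric.infDist_nonneg (x := x) (s := T)
  gcongr

lemma integral_sub_sq (a b t : ℝ) :
    ∫ x in a..b, (x - t) ^ 2 = (b - a) ^ 3 / 12 + (b - a) * (t - (a + b) / 2) ^ 2 := by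
  rw [intervalIntegral.integral_comp_sub_right (fun x => x ^ 2), integral_pow]
  norm_num
  ring

lemma continuous_sq_infDist (T : Set ℝ) : Continuous fun x => Metric.infDist x T ^ 2 :=
  (Metric.continuous_infDist_pt T).pow 2

/-- The midpoints of `k` intervals of equal length which partition `[0, d]`. -/
noncomputable def midpoints (k : ℕ) (d : ℝ) : Finset ℝ :=
  (Finset.range k).image fun i : ℕ => (2 * (i : ℝ) + 1) * d / (2 * k)

lemma eq_of_div_eq_sub {c d e : ℝ} (hc : 0 < c) (h : 1 / c * e = 1 * (d - e)) :
    e = c * d / (c + 1) := by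
  rw [eq_div_iff (by positivity)]
  field_simp at h
  linarith

lemma midpoint_of_rescale {c : ℝ} (hc : 0 < c) (d i : ℝ) :
    i * (c * d / (c + 1)) / (2 * c) = i * d / (2 * (c + 1)) := by
  field_simp

lemma midpoint_last {c : ℝ} (hc : 0 < c) (d : ℝ) :
    (c * d / (c + 1) + d) / 2 = (2 * c + 1) * d / (2 * (c + 1)) := by
  field_simp
  ring

lemma sub_mul_div_add_one {c : ℝ} (hc : 0 < c) (d : ℝ) :
    d - c * d / (c + 1) = d / (c + 1) := by
  field_simp
  ring

/-- Induction on the largest point `t`: it serves a final segment `[e, d]`, the other points serve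
`[0, e]`, and the inequality for cubes optimizes `e`. Uniqueness needs `0 < d`, since every `T` has
zero error on a degenerate interval. -/
lemma quantization_lower (T : Finset ℝ) : T.Nonempty → ∀ d : ℝ, 0 ≤ d →
    d ^ 3 / (12 * (T.card : ℝ) ^ 2) ≤ ∫ x in (0 : ℝ)..d, Metric.infDist x (T : Set ℝ) ^ 2 ∧
    (0 < d → ∫ x in (0 : ℝ)..d, Metric.infDist x (T : Set ℝ) ^ 2 ≤ d ^ 3 / (12 * (T.card : ℝ) ^ 2) →
      T = midpoints T.card d) := by
  induction T using Finset.induction_on_max with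
  | empty => simp
  | insert t T hmax ih =>
    intro _ d hd
    have htT : t ∉ T := fun h => lt_irrefl _ (hmax t h)
    rcases T.eq_empty_or_nonempty with rfl | hT
    · have h : ∫ x in (0 : ℝ)..d, Metric.infDist x ((insert t ∅ : Finset ℝ) : Set ℝ) ^ 2 =
          d ^ 3 / 12 + d * (t - d / 2) ^ 2 := by
        have := integral_sub_sq 0 d t
        simpa [Metric.infDist_singleton, Real.dist_eq, sq_abs] using this
      rw [h]
      simp only [insert_empty_eq, Finset.card_singleton, Nat.cast_one]
      refine ⟨by nlinarith [mul_nonneg hd (sq_nonneg (t - d / 2))], fun hd hle => ?_⟩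
      have h1 : d * (t - d / 2) ^ 2 ≤ 0 := by linarith
      have h2 : (t - d / 2) ^ 2 ≤ 0 := nonpos_of_mul_nonpos_right h1 hd
      have h3 : t - d / 2 = 0 := by nlinarith [pow_eq_zero_iff (two_ne_zero) |>.1 (le_antisymm h2 (sq_nonneg _))]
      simp [midpoints]
      linarith
    · obtain ⟨e, he0, hed, hlo, hhi⟩ := exists_sign_change
        (h := fun x => Metric.infDist x (T : Set ℝ) ^ 2 - (x - t) ^ 2)
        -- With `s` nearest to `y`, the difference at `x` is at most `(x - s)² - (x - t)²`, which is
        -- affine in `x` with slope `2 (t - s) > 0`.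
        ((continuous_sq_infDist _).sub (by fun_prop)) hd (by
          intro x y hx hxy hy
          obtain ⟨s, hs, hs'⟩ := exists_abs_eq_infDist hT y
          have h1 := sq_infDist_le (T := (T : Set ℝ)) hs x
          have h2 := hmax s hs
          rw [hs']
          nlinarith)
      have hle : ∀ x, Metric.infDist x ((insert t T : Finset ℝ) : Set ℝ) ^ 2 =
          min (Metric.infDist x (T : Set ℝ) ^ 2) ((x - t) ^ 2) := by
        intro x
        apply le_antisymm
        · refine le_min ?_ (sq_infDist_le (by simp) x)
          obtain ⟨s, hs, hs'⟩ := exists_abs_eq_infDist hT x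
          rw [hs']
          exact sq_infDist_le (by simp [hs]) x
        · obtain ⟨s, hs, hs'⟩ := exists_abs_eq_infDist (Finset.insert_nonempty t T) x
          rw [hs']
          rcases Finset.mem_insert.1 hs with rfl | hs
          · exact min_le_right _ _
          · exact (min_le_left _ _).trans (sq_infDist_le hs x)
      have hI : ∫ x in (0 : ℝ)..d, Metric.infDist x ((insert t T : Finset ℝ) : Set ℝ) ^ 2 =
          (∫ x in (0 : ℝ)..e, Metric.infDist x (T : Set ℝ) ^ 2) +
            ((d - e) ^ 3 / 12 + (d - e) * (t - (e + d) / 2) ^ 2) := by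
        rw [← integral_sub_sq, ← intervalIntegral.integral_add_adjacent_intervals (b := e)
          ((continuous_sq_infDist _).intervalIntegrable _ _)
          ((continuous_sq_infDist _).intervalIntegrable _ _)]
        congr 1
        · refine intervalIntegral.integral_congr_Ioo_of_le he0 fun x hx => ?_
          have := hlo x hx
          simp only [hle]
          exact min_eq_left (by linarith)
        · refine intervalIntegral.integral_congr_Ioo_of_le hed fun x hx => ?_
          have := hhi x hx
          simp only [hle]
          exact min_eq_right (by linarith)
      obtain ⟨ih1, ih2⟩ := ih hT e he0
      have hk : (0 : ℝ) < T.card := by exact_mod_cast hT.card_pos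
      have hcard : ((insert t T).card : ℝ) = T.card + 1 := by
        rw [Finset.card_insert_of_notMem htT]; push_cast; rfl
      -- The weights are those of `e³ / k² + (d - e)³` with `k = T.card`; its minimum is `d³ / (k +
      -- 1)²`.
      have hcub := min_le_cubes (p := 1 / T.card) (q := 1) (x := e) (y := d - e)
        (by positivity) one_pos he0 (by linarith)
      have hq : (1 / (T.card : ℝ)) ^ 2 * 1 ^ 2 * (e + (d - e)) ^ 3 / (1 / T.card + 1) ^ 2 =
          12 * (d ^ 3 / (12 * ((insert t T).card : ℝ) ^ 2)) := by
        rw [hcard]; field_simp; ring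
      have hp : e ^ 3 / (12 * (T.card : ℝ) ^ 2) = (1 / (T.card : ℝ)) ^ 2 * e ^ 3 / 12 := by
        field_simp
      have hsq : 0 ≤ (d - e) * (t - (e + d) / 2) ^ 2 :=
        mul_nonneg (by linarith) (sq_nonneg _)
      rw [hI]
      rw [hq] at hcub
      refine ⟨by linarith, fun hd hle => ?_⟩
      have heq := mul_eq_mul_of_cubes_le_min (p := 1 / T.card) (q := 1) (x := e) (y := d - e)
        (by positivity) one_pos he0 (by linarith) (by rw [hq]; linarith)
      have he : e = T.card * d / (T.card + 1) := eq_of_div_eq_sub hk heq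
      have hepos : 0 < e := by rw [he]; positivity
      have hde : 0 < d - e := by
        have : d - e = d / (T.card + 1) := by rw [he, sub_mul_div_add_one hk]
        rw [this]; positivity
      have hT' := ih2 hepos (by linarith)
      have h1 : (d - e) * (t - (e + d) / 2) ^ 2 ≤ 0 := by linarith
      have h2 : (t - (e + d) / 2) ^ 2 ≤ 0 := nonpos_of_mul_nonpos_right h1 hde
      have h3 := sub_eq_zero.1 (pow_eq_zero_iff two_ne_zero |>.1 (le_antisymm h2 (sq_nonneg _)))
      rw [Finset.card_insert_of_notMem htT, midpoints, Finset.range_add_one, Finset.image_insert]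
      congr 1
      · rw [h3, he, midpoint_last hk]; push_cast; rfl
      · conv_lhs => rw [hT', midpoints]
        refine Finset.image_congr fun i _ => ?_
        simp only [he]
        rw [midpoint_of_rescale hk]
        push_cast
        rfl

/-- Each cell of length `d / k` is charged to its own midpoint, at cost `(d / k)³ / 12`. -/
lemma quantization_upper {k : ℕ} (hk : 0 < k) {d : ℝ} (hd : 0 ≤ d) :
    ∫ x in (0 : ℝ)..d, Metric.infDist x (midpoints k d : Set ℝ) ^ 2 ≤ d ^ 3 / (12 * (k : ℝ) ^ 2) := by
  have hk' : (0 : ℝ) < k := by exact_mod_cast hk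
  have key : ∀ j : ℕ, j ≤ k → ∫ x in (0 : ℝ)..(j * (d / k)),
      Metric.infDist x (midpoints k d : Set ℝ) ^ 2 ≤ j * ((d / k) ^ 3 / 12) := by
    intro j
    induction j with
    | zero => simp
    | succ j ih =>
      intro hj
      have h1 := ih (by omega)
      rw [← intervalIntegral.integral_add_adjacent_intervals (b := j * (d / k))
          ((continuous_sq_infDist _).intervalIntegrable _ _)
          ((continuous_sq_infDist _).intervalIntegrable _ _)]
      have h2 : ∫ x in (j * (d / k))..((j + 1 : ℕ) * (d / k)),
          Metric.infDist x (midpoints k d : Set ℝ) ^ 2 ≤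
          ∫ x in (j * (d / k))..((j + 1 : ℕ) * (d / k)), (x - (2 * (j : ℝ) + 1) * d / (2 * k)) ^ 2 := by
        refine intervalIntegral.integral_mono_on ?_
          ((continuous_sq_infDist _).intervalIntegrable _ _)
          (Continuous.intervalIntegrable (by fun_prop) _ _) fun x _ => sq_infDist_le ?_ x
        · push_cast
          have : 0 ≤ d / k := by positivity
          nlinarith
        · simp only [midpoints, Finset.coe_image, Finset.coe_range]
          exact ⟨j, by simpa using hj, rfl⟩
      rw [integral_sub_sq] at h2
      have h3 : (((j + 1 : ℕ) : ℝ) * (d / k) - j * (d / k)) = d / k := by push_cast; ring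
      have h4 : (2 * (j : ℝ) + 1) * d / (2 * k) -
          (j * (d / k) + ((j + 1 : ℕ) : ℝ) * (d / k)) / 2 = 0 := by
        push_cast; field_simp; ring
      rw [h3, h4] at h2
      push_cast at h1 h2 ⊢
      linarith
  have h := key k le_rfl
  rw [mul_div_cancel₀ _ hk'.ne'] at h
  refine h.trans (le_of_eq ?_)
  field_simp

/-! ### Reduction from the plane to the line -/

/-- The points of the lines through `O`, `B` and through `A`, `B`, whose distance from the vertex on
the base is half of an element of `T` and of `U`, respectively. -/
def sidePoints (T U : Finset ℝ) : Set Plane :=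
  (fun t : ℝ => pointOB (t / 4)) '' T ∪ (fun s : ℝ => pointAB (2 - s / 4)) '' U

/-- The squared distance of the base point `(x, 0)` from the points `(t / 4, t √3 / 4)`, `t ∈ T`. -/
noncomputable def sideCost (T : Finset ℝ) (x : ℝ) : ℝ :=
  3 / 4 * x ^ 2 + 1 / 4 * Metric.infDist x (T : Set ℝ) ^ 2

lemma continuous_sideCost (T : Finset ℝ) : Continuous (sideCost T) := by
  have := continuous_sq_infDist (T : Set ℝ)
  unfold sideCost
  fun_prop

/-- The base point `(t, 0)` is the one that projects orthogonally onto `pointOB (t / 4)`, hence the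
factor 4 in the parametrization. -/
lemma dist_pointOB_sq (x t : ℝ) :
    dist (!₂[x, 0] : Plane) (pointOB (t / 4)) ^ 2 = 3 / 4 * x ^ 2 + 1 / 4 * (x - t) ^ 2 := by
  have h3 : √3 ^ 2 = (3 : ℝ) := Real.sq_sqrt (by norm_num)
  rw [EuclideanSpace.dist_eq, Real.sq_sqrt (by positivity)]
  simp only [pointOB, Fin.sum_univ_two, Real.dist_eq, sq_abs]
  simp
  rw [mul_pow, h3]
  ring

lemma dist_pointAB_sq (x s : ℝ) :
    dist (!₂[x, 0] : Plane) (pointAB (2 - s / 4)) ^ 2 =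
      3 / 4 * (2 - x) ^ 2 + 1 / 4 * ((2 - x) - s) ^ 2 := by
  have h3 : √3 ^ 2 = (3 : ℝ) := Real.sq_sqrt (by norm_num)
  rw [EuclideanSpace.dist_eq, Real.sq_sqrt (by positivity)]
  simp only [pointAB, Fin.sum_univ_two, Real.dist_eq, sq_abs]
  simp
  rw [mul_pow, h3]
  ring

lemma finite_sidePoints (T U : Finset ℝ) : (sidePoints T U).Finite :=
  (T.finite_toSet.image _).union (U.finite_toSet.image _)

lemma sidePoints_nonempty {T : Finset ℝ} (hT : T.Nonempty) (U : Finset ℝ) :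
    (sidePoints T U).Nonempty :=
  ((Finset.coe_nonempty.2 hT).image _).inl

lemma iInf_dist_sq_sidePoints {T U : Finset ℝ} (hT : T.Nonempty) (hU : U.Nonempty) (x : ℝ) :
    ⨅ a : sidePoints T U, dist (!₂[x, 0] : Plane) (a : Plane) ^ 2 =
      min (sideCost T x) (sideCost U (2 - x)) := by
  have : Nonempty (sidePoints T U) := (sidePoints_nonempty hT U).to_subtype
  have hbdd : BddBelow (Set.range fun a : sidePoints T U =>
      dist (!₂[x, 0] : Plane) (a : Plane) ^ 2) := ⟨0, by rintro _ ⟨a, rfl⟩; positivity⟩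
  apply le_antisymm
  · obtain ⟨t, ht, ht'⟩ := exists_abs_eq_infDist hT x
    obtain ⟨s, hs, hs'⟩ := exists_abs_eq_infDist hU (2 - x)
    rw [sideCost, sideCost, ht', hs', ← dist_pointOB_sq, ← dist_pointAB_sq]
    exact le_min (ciInf_le hbdd ⟨_, Or.inl ⟨t, ht, rfl⟩⟩) (ciInf_le hbdd ⟨_, Or.inr ⟨s, hs, rfl⟩⟩)
  · refine le_ciInf ?_
    rintro ⟨_, ⟨t, ht, rfl⟩ | ⟨s, hs, rfl⟩⟩
    · refine (min_le_left _ _).trans ?_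
      simp only [dist_pointOB_sq, sideCost]
      gcongr 3 / 4 * x ^ 2 + 1 / 4 * ?_
      exact sq_infDist_le ht x
    · refine (min_le_right _ _).trans ?_
      simp only [dist_pointAB_sq, sideCost]
      gcongr 3 / 4 * (2 - x) ^ 2 + 1 / 4 * ?_
      exact sq_infDist_le hs (2 - x)

/-- Gives continuity of the integrand on the plane, needed to integrate against the image measure.
-/
lemma iInf_dist_sq_eq_infDist {α : Set Plane} (hα : α.Finite) (hne : α.Nonempty) (p : Plane) :
    ⨅ a : α, dist p (a : Plane) ^ 2 = Metric.infDist p α ^ 2 := by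
  have : Nonempty α := hne.to_subtype
  apply le_antisymm
  · obtain ⟨a, ha, h⟩ := hα.isCompact.exists_infDist_eq_dist hne p
    rw [h]
    exact ciInf_le (f := fun a : α => dist p (a : Plane) ^ 2)
      ⟨0, by rintro _ ⟨a, rfl⟩; positivity⟩ ⟨a, ha⟩
  · refine le_ciInf fun a => ?_
    have := Metric.infDist_nonneg (x := p) (s := α)
    have := Metric.infDist_le_dist_of_mem (x := p) a.2
    gcongr

lemma distortion_sidePoints {T U : Finset ℝ} (hT : T.Nonempty) (hU : U.Nonempty) :
    distortion baseUniform (sidePoints T U) =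
      1 / 2 * ∫ x in (0 : ℝ)..2, min (sideCost T x) (sideCost U (2 - x)) := by
  have hmeas : Measurable fun x : ℝ => (!₂[x, 0] : Plane) := by
    have : Continuous fun x : ℝ => (!₂[x, 0] : Plane) := by fun_prop
    exact this.measurable
  have hc : Continuous fun p : Plane => ⨅ a : sidePoints T U, dist p (a : Plane) ^ 2 := by
    simp only [iInf_dist_sq_eq_infDist (finite_sidePoints T U) (sidePoints_nonempty hT U)]
    exact (Metric.continuous_infDist_pt _).pow 2
  rw [distortion, baseUniform, integral_map hmeas.aemeasurable hc.aestronglyMeasurable,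
    ProbabilityTheory.cond, integral_smul_measure, integral_Icc_eq_integral_Ioc,
    ← intervalIntegral.integral_of_le (by norm_num)]
  simp only [iInf_dist_sq_sidePoints hT hU]
  simp

/-! ### Optimal division of the base between the two sides -/

/-- The square root of the least integral of `sideCost T` over `[0, 1]` for sets `T` of `k` reals. -/
noncomputable def sideCoeff (k : ℕ) : ℝ := √((12 * (k : ℝ) ^ 2 + 1) / (48 * (k : ℝ) ^ 2))

lemma sideCoeff_sq (k : ℕ) : sideCoeff k ^ 2 = (12 * (k : ℝ) ^ 2 + 1) / (48 * (k : ℝ) ^ 2) :=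
  Real.sq_sqrt (by positivity)

lemma sideCoeff_pos {k : ℕ} (hk : 0 < k) : 0 < sideCoeff k := by
  have : (0 : ℝ) < k := by exact_mod_cast hk
  exact Real.sqrt_pos.2 (by positivity)

lemma integral_sideCost (T : Finset ℝ) (d : ℝ) :
    ∫ x in (0 : ℝ)..d, sideCost T x =
      d ^ 3 / 4 + 1 / 4 * ∫ x in (0 : ℝ)..d, Metric.infDist x (T : Set ℝ) ^ 2 := by
  have h := continuous_sq_infDist (T : Set ℝ)
  simp only [sideCost]
  rw [intervalIntegral.integral_add (Continuous.intervalIntegrable (by fun_prop) _ _)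
    (Continuous.intervalIntegrable (by fun_prop) _ _), intervalIntegral.integral_const_mul,
    intervalIntegral.integral_const_mul, integral_pow]
  norm_num

lemma sideCoeff_sq_mul {k : ℕ} (hk : 0 < k) (d : ℝ) :
    sideCoeff k ^ 2 * d ^ 3 = d ^ 3 / 4 + 1 / 4 * (d ^ 3 / (12 * (k : ℝ) ^ 2)) := by
  have : (0 : ℝ) < k := by exact_mod_cast hk
  rw [sideCoeff_sq]
  field_simp
  ring

lemma min_cost_eq_split {T U : Finset ℝ} (hT : T.Nonempty) (hU : U.Nonempty)
    (hT4 : ∀ t ∈ T, t ≤ 4) (hU4 : ∀ s ∈ U, s ≤ 4) :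
    ∃ d, 0 ≤ d ∧ d ≤ 2 ∧ ∫ x in (0 : ℝ)..2, min (sideCost T x) (sideCost U (2 - x)) =
      (∫ x in (0 : ℝ)..d, sideCost T x) + ∫ x in (0 : ℝ)..(2 - d), sideCost U x := by
  have hcT := continuous_sideCost T
  have hcU : Continuous fun x => sideCost U (2 - x) := (continuous_sideCost U).comp (by fun_prop)
  obtain ⟨d, hd0, hd2, hlo, hhi⟩ := exists_sign_change
    (h := fun x => sideCost T x - sideCost U (2 - x)) (hcT.sub hcU) zero_le_two (by
      -- For fixed `t` and `s` the difference of the two costs is affine in `x` with slope `4 - (t +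
      -- s) / 2`, nonnegative because `t, s ≤ 4`.
      intro x y hx hxy hy
      obtain ⟨t, ht, ht'⟩ := exists_abs_eq_infDist hT y
      obtain ⟨s, hs, hs'⟩ := exists_abs_eq_infDist hU (2 - x)
      have h1 := sq_infDist_le (T := (T : Set ℝ)) ht x
      have h2 := sq_infDist_le (T := (U : Set ℝ)) hs (2 - y)
      have h3 := hT4 t ht
      have h4 := hU4 s hs
      simp only [sideCost]
      rw [ht', hs']
      nlinarith)
  refine ⟨d, hd0, hd2, ?_⟩
  have hcomp := intervalIntegral.integral_comp_sub_left (a := d) (b := 2) (sideCost U) 2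
  rw [sub_self] at hcomp
  rw [← hcomp, ← intervalIntegral.integral_add_adjacent_intervals (b := d)
    ((hcT.min hcU).intervalIntegrable _ _) ((hcT.min hcU).intervalIntegrable _ _)]
  congr 1
  · refine intervalIntegral.integral_congr_Ioo_of_le hd0 fun x hx => ?_
    exact min_eq_left (sub_nonpos.1 (hlo x hx))
  · refine intervalIntegral.integral_congr_Ioo_of_le hd2 fun x hx => ?_
    exact min_eq_right (sub_nonneg.1 (hhi x hx))

lemma min_cost_rigid {T U : Finset ℝ} (hT : T.Nonempty) (hU : U.Nonempty)
    (hT4 : ∀ t ∈ T, t ≤ 4) (hU4 : ∀ s ∈ U, s ≤ 4) {p q : ℝ} (hp : p = sideCoeff T.card)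
    (hq : q = sideCoeff U.card) :
    p ^ 2 * q ^ 2 * 2 ^ 3 / (p + q) ^ 2 ≤
      ∫ x in (0 : ℝ)..2, min (sideCost T x) (sideCost U (2 - x)) ∧
    (∫ x in (0 : ℝ)..2, min (sideCost T x) (sideCost U (2 - x)) ≤
      p ^ 2 * q ^ 2 * 2 ^ 3 / (p + q) ^ 2 →
    T = midpoints T.card (2 * q / (p + q)) ∧ U = midpoints U.card (2 - 2 * q / (p + q))) := by
  obtain ⟨d, hd0, hd2, hI⟩ := min_cost_eq_split hT hU hT4 hU4
  have hp0 : 0 < p := hp ▸ sideCoeff_pos hT.card_pos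
  have hq0 : 0 < q := hq ▸ sideCoeff_pos hU.card_pos
  obtain ⟨hT1, hT2⟩ := quantization_lower T hT d hd0
  obtain ⟨hU1, hU2⟩ := quantization_lower U hU (2 - d) (by linarith)
  have hpd := sideCoeff_sq_mul hT.card_pos d
  have hqd := sideCoeff_sq_mul hU.card_pos (2 - d)
  rw [← hp] at hpd
  rw [← hq] at hqd
  rw [hI, integral_sideCost, integral_sideCost]
  have h8 := min_le_cubes hp0 hq0 hd0 (show 0 ≤ 2 - d by linarith)
  rw [add_sub_cancel] at h8
  refine ⟨by linarith, fun h => ?_⟩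
  have heq := mul_eq_mul_of_cubes_le_min hp0 hq0 hd0 (show 0 ≤ 2 - d by linarith)
    (by rw [add_sub_cancel]; linarith)
  have hd : 2 * q / (p + q) = d := by
    rw [div_eq_iff (by positivity)]
    linarith
  have hd' : 0 < d := by rw [← hd]; positivity
  -- At `d = 2` the balance `p d = q (2 - d)` would give `p d = 0`.
  have hd'' : 0 < 2 - d := by
    by_contra hcon
    have h2 : 2 - d = 0 := by linarith
    rw [h2, mul_zero] at heq
    exact absurd heq (by positivity)
  rw [hd]
  exact ⟨hT2 hd' (by linarith), hU2 hd'' (by linarith)⟩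

lemma midpoints_nonempty {k : ℕ} (hk : 0 < k) (d : ℝ) : (midpoints k d).Nonempty :=
  (Finset.nonempty_range_iff.2 hk.ne').image _

lemma card_midpoints_le (k : ℕ) (d : ℝ) : (midpoints k d).card ≤ k :=
  Finset.card_image_le.trans (Finset.card_range k).le

lemma midpoints_bounds {k : ℕ} {d : ℝ} (hd : 0 ≤ d) {t : ℝ} (ht : t ∈ midpoints k d) :
    0 ≤ t ∧ t ≤ d := by
  obtain ⟨i, hi, rfl⟩ := Finset.mem_image.1 ht
  have hi' : (i : ℝ) + 1 ≤ k := by exact_mod_cast Finset.mem_range.1 hi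
  have hk : (0 : ℝ) < k := by linarith [(Nat.cast_nonneg i : (0 : ℝ) ≤ i)]
  refine ⟨by positivity, ?_⟩
  rw [div_le_iff₀ (by positivity)]
  nlinarith

lemma min_cost_midpoints_le {l m : ℕ} (hl : 0 < l) (hm : 0 < m) {d : ℝ} (hd0 : 0 ≤ d)
    (hd2 : d ≤ 2) :
    ∫ x in (0 : ℝ)..2, min (sideCost (midpoints l d) x) (sideCost (midpoints m (2 - d)) (2 - x)) ≤
      sideCoeff l ^ 2 * d ^ 3 + sideCoeff m ^ 2 * (2 - d) ^ 3 := by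
  have hcT := continuous_sideCost (midpoints l d)
  have hcU : Continuous fun x => sideCost (midpoints m (2 - d)) (2 - x) :=
    (continuous_sideCost _).comp (by fun_prop)
  have hcomp := intervalIntegral.integral_comp_sub_left (a := d) (b := 2)
    (sideCost (midpoints m (2 - d))) 2
  rw [sub_self] at hcomp
  rw [← intervalIntegral.integral_add_adjacent_intervals (b := d)
    ((hcT.min hcU).intervalIntegrable _ _) ((hcT.min hcU).intervalIntegrable _ _)]
  have h1 := intervalIntegral.integral_mono_on (μ := volume) hd0 ((hcT.min hcU).intervalIntegrable 0 d)
    (hcT.intervalIntegrable 0 d) fun x _ => min_le_left _ _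
  have h2 := intervalIntegral.integral_mono_on (μ := volume) hd2 ((hcT.min hcU).intervalIntegrable d 2)
    (hcU.intervalIntegrable d 2) fun x _ => min_le_right _ _
  rw [integral_sideCost] at h1
  rw [hcomp, integral_sideCost] at h2
  have h3 := quantization_upper hl hd0
  have h4 := quantization_upper hm (show 0 ≤ 2 - d by linarith)
  rw [sideCoeff_sq_mul hl, sideCoeff_sq_mul hm]
  linarith

/-! ### Comparison with the midpoint configuration -/

lemma pointOB_mem {a : ℝ} (h0 : 0 ≤ a) (h1 : a ≤ 1) : pointOB a ∈ sideOB := by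
  refine ⟨by simpa [pointOB], by simpa [pointOB], by simp [pointOB, mul_comm]⟩

lemma pointAB_mem {b : ℝ} (h1 : 1 ≤ b) (h2 : b ≤ 2) : pointAB b ∈ sideAB := by
  refine ⟨by simpa [pointAB], by simpa [pointAB], ?_⟩
  simp [pointAB]
  ring

lemma encard_sidePoints_le (T U : Finset ℝ) :
    (sidePoints T U).encard ≤ ((T.card + U.card : ℕ) : ℕ∞) := by
  refine (Set.encard_union_le _ _).trans ?_
  push_cast
  rw [← Set.encard_coe_eq_coe_finsetCard T, ← Set.encard_coe_eq_coe_finsetCard U]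
  exact add_le_add (Set.encard_image_le _ _) (Set.encard_image_le _ _)

lemma constrainedError_le {P : Measure Plane} {S α : Set Plane} {n : ℕ} (hS : α ⊆ S)
    (h1 : 1 ≤ α.encard) (hn : α.encard ≤ n) : constrainedError P S n ≤ distortion P α := by
  refine csInf_le ⟨0, ?_⟩ ⟨α, hS, h1, hn, rfl⟩
  rintro _ ⟨β, -, -, -, rfl⟩
  exact integral_nonneg fun x => Real.iInf_nonneg fun a => sq_nonneg _

theorem optimal_sidePoints {T U : Finset ℝ} {n : ℕ} (hT : T.Nonempty) (hU : U.Nonempty)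
    (hT4 : ∀ t ∈ T, t ≤ 4) (hU4 : ∀ s ∈ U, s ≤ 4) (hn : T.card + U.card ≤ n)
    (hopt : IsOptimalSet baseUniform (sideOB ∪ sideAB) n (sidePoints T U))
    {p q : ℝ} (hp : p = sideCoeff T.card) (hq : q = sideCoeff U.card) :
    T = midpoints T.card (2 * q / (p + q)) ∧ U = midpoints U.card (2 - 2 * q / (p + q)) ∧
      constrainedError baseUniform (sideOB ∪ sideAB) n = 4 * p ^ 2 * q ^ 2 / (p + q) ^ 2 := by
  have hp0 : 0 < p := hp ▸ sideCoeff_pos hT.card_pos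
  have hq0 : 0 < q := hq ▸ sideCoeff_pos hU.card_pos
  have hd0 : 0 ≤ 2 * q / (p + q) := by positivity
  have hd2 : 2 * q / (p + q) ≤ 2 := by
    rw [div_le_iff₀ (by positivity)]
    linarith
  obtain ⟨hlow, hrig⟩ := min_cost_rigid hT hU hT4 hU4 hp hq
  have hup := min_cost_midpoints_le hT.card_pos hU.card_pos hd0 hd2
  have hval : p ^ 2 * (2 * q / (p + q)) ^ 3 + q ^ 2 * (2 - 2 * q / (p + q)) ^ 3 =
      p ^ 2 * q ^ 2 * 2 ^ 3 / (p + q) ^ 2 := by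
    field_simp
    ring
  rw [← hp, ← hq, hval] at hup
  have hT' := midpoints_nonempty hT.card_pos (2 * q / (p + q))
  have hU' := midpoints_nonempty hU.card_pos (2 - 2 * q / (p + q))
  have hle := constrainedError_le (P := baseUniform) (S := sideOB ∪ sideAB) (n := n)
    (α := sidePoints (midpoints T.card (2 * q / (p + q)))
      (midpoints U.card (2 - 2 * q / (p + q)))) (by
      rintro _ (⟨t, ht, rfl⟩ | ⟨s, hs, rfl⟩)
      · have := midpoints_bounds hd0 ht
        exact Or.inl (pointOB_mem (by linarith) (by linarith))
      · have := midpoints_bounds (by linarith) hs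
        exact Or.inr (pointAB_mem (by linarith) (by linarith)))
    (Set.one_le_encard_iff_nonempty.2 (sidePoints_nonempty hT' _))
    ((encard_sidePoints_le _ _).trans (by
      exact_mod_cast (add_le_add (card_midpoints_le _ _) (card_midpoints_le _ _)).trans hn))
  rw [distortion_sidePoints hT' hU'] at hle
  have heq := hopt.2.2.2
  rw [← heq, distortion_sidePoints hT hU] at hle
  obtain ⟨h1, h2⟩ := hrig (by linarith)
  refine ⟨h1, h2, ?_⟩
  rw [← heq, distortion_sidePoints hT hU, le_antisymm (by linarith) hlow]
  ring

/-! ### Parametrizing an optimal set and excluding the vertex `B` -/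

lemma exists_finset_sideOB {α : Set Plane} {l : ℕ} (h : (α ∩ sideOB).encard = l) :
    ∃ T : Finset ℝ, T.card = l ∧ (∀ t ∈ T, t ≤ 4) ∧
      (fun t : ℝ => pointOB (t / 4)) '' T = α ∩ sideOB := by
  have hfin : (α ∩ sideOB).Finite := Set.finite_of_encard_eq_coe h
  have hinv : ∀ p ∈ α ∩ sideOB, pointOB (4 * p 0 / 4) = p := by
    rintro p ⟨-, -, -, h1⟩
    ext i
    fin_cases i
    · simp [pointOB]
    · simp [pointOB, h1, mul_comm]
  refine ⟨hfin.toFinset.image fun p => 4 * p 0, ?_, ?_, ?_⟩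
  · rw [Finset.card_image_of_injOn, ← Nat.cast_inj (R := ℕ∞), ← Set.encard_coe_eq_coe_finsetCard,
      hfin.coe_toFinset, h]
    intro p hp r hr hpr
    rw [hfin.coe_toFinset] at hp hr
    simp only at hpr
    rw [← hinv p hp, ← hinv r hr, hpr]
  · simp only [Finset.mem_image, Set.Finite.mem_toFinset]
    rintro _ ⟨p, hp, rfl⟩
    linarith [hp.2.2.1]
  · rw [Finset.coe_image, hfin.coe_toFinset, Set.image_image]
    exact (Set.image_congr hinv).trans (Set.image_id' _)

lemma exists_finset_sideAB {α : Set Plane} {m : ℕ} (h : (α ∩ sideAB).encard = m) :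
    ∃ U : Finset ℝ, U.card = m ∧ (∀ s ∈ U, s ≤ 4) ∧
      (fun s : ℝ => pointAB (2 - s / 4)) '' U = α ∩ sideAB := by
  have hfin : (α ∩ sideAB).Finite := Set.finite_of_encard_eq_coe h
  have hinv : ∀ p ∈ α ∩ sideAB, pointAB (2 - 4 * (2 - p 0) / 4) = p := by
    rintro p ⟨-, -, -, h1⟩
    ext i
    fin_cases i
    · simp [pointAB]
    · simp [pointAB, h1]
      ring
  refine ⟨hfin.toFinset.image fun p => 4 * (2 - p 0), ?_, ?_, ?_⟩
  · rw [Finset.card_image_of_injOn, ← Nat.cast_inj (R := ℕ∞), ← Set.encard_coe_eq_coe_finsetCard,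
      hfin.coe_toFinset, h]
    intro p hp r hr hpr
    rw [hfin.coe_toFinset] at hp hr
    simp only at hpr
    rw [← hinv p hp, ← hinv r hr, hpr]
  · simp only [Finset.mem_image, Set.Finite.mem_toFinset]
    rintro _ ⟨p, hp, rfl⟩
    linarith [hp.2.1]
  · rw [Finset.coe_image, hfin.coe_toFinset, Set.image_image]
    exact (Set.image_congr hinv).trans (Set.image_id' _)

lemma inter_sides_subset : sideOB ∩ sideAB ⊆ {pointOB 1} := by
  rintro p ⟨⟨-, h1, h2⟩, h3, -, -⟩
  have h : p 0 = 1 := le_antisymm h1 h3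
  ext i
  fin_cases i
  · simp [pointOB, h]
  · simp [pointOB, h2, h]

lemma image_pointOB_midpoints (l : ℕ) (d : ℝ) :
    (fun t : ℝ => pointOB (t / 4)) '' (midpoints l d) =
      {p | ∃ i : ℕ, 1 ≤ i ∧ i ≤ l ∧ p = pointOB ((2 * (i : ℝ) - 1) * (d / (4 * l)) / 2)} := by
  ext p
  simp only [midpoints, Finset.coe_image, Finset.coe_range, Set.image_image, Set.mem_image,
    Set.mem_Iio, Set.mem_ofPred_eq]
  constructor
  · rintro ⟨i, hi, rfl⟩
    refine ⟨i + 1, by omega, by omega, ?_⟩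
    congr 1
    push_cast
    ring
  · rintro ⟨i, h1, hi, rfl⟩
    obtain ⟨j, rfl⟩ := Nat.exists_eq_add_of_le' h1
    refine ⟨j, by omega, ?_⟩
    congr 1
    push_cast
    ring

lemma image_pointAB_midpoints (m : ℕ) (d : ℝ) :
    (fun s : ℝ => pointAB (2 - s / 4)) '' (midpoints m d) =
      {p | ∃ j : ℕ, 1 ≤ j ∧ j ≤ m ∧ p = pointAB (2 - (2 * (j : ℝ) - 1) * (d / (4 * m)) / 2)} := by
  ext p
  simp only [midpoints, Finset.coe_image, Finset.coe_range, Set.image_image, Set.mem_image,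
    Set.mem_Iio, Set.mem_ofPred_eq]
  constructor
  · rintro ⟨i, hi, rfl⟩
    refine ⟨i + 1, by omega, by omega, ?_⟩
    congr 2
    push_cast
    ring
  · rintro ⟨i, h1, hi, rfl⟩
    obtain ⟨j, rfl⟩ := Nat.exists_eq_add_of_le' h1
    refine ⟨j, by omega, ?_⟩
    congr 2
    push_cast
    ring

lemma sideCoeff_eq (k : ℕ) : sideCoeff k = √(12 * (k : ℝ) ^ 2 + 1) / (√48 * k) := by
  rw [sideCoeff, Real.sqrt_div (by positivity), Real.sqrt_mul (by norm_num),
    Real.sqrt_sq (Nat.cast_nonneg k)]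

theorem theorem3p1 (n : ℕ) (hn : 6 ≤ n) (α : Set Plane)
    (hα : IsOptimalSet baseUniform (sideOB ∪ sideAB) n α)
    (l m : ℕ) (hl : 3 ≤ l) (hm : 3 ≤ m)
    (hαl : (α ∩ sideOB).encard = l) (hαm : (α ∩ sideAB).encard = m)
    (u v : ℝ)
    (hu : u = 1 / (2 * ((12 * (l : ℝ) ^ 2 + 1) * m /
      √((12 * (l : ℝ) ^ 2 + 1) * (12 * (m : ℝ) ^ 2 + 1)) + l)))
    (hv : v = 1 / (2 * (l * (12 * (m : ℝ) ^ 2 + 1) /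
      √((12 * (l : ℝ) ^ 2 + 1) * (12 * (m : ℝ) ^ 2 + 1)) + m))) :
    α = {p | ∃ i : ℕ, 1 ≤ i ∧ i ≤ l ∧ p = pointOB ((2 * (i : ℝ) - 1) * u / 2)} ∪
        {p | ∃ j : ℕ, 1 ≤ j ∧ j ≤ m ∧ p = pointAB (2 - (2 * (j : ℝ) - 1) * v / 2)} ∧
    constrainedError baseUniform (sideOB ∪ sideAB) n =
      (12 * (l : ℝ) ^ 2 + 1) * (12 * (m : ℝ) ^ 2 + 1) /
        (12 * (24 * (l : ℝ) ^ 2 * (m : ℝ) ^ 2 +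
          2 * l * m * √((12 * (l : ℝ) ^ 2 + 1) * (12 * (m : ℝ) ^ 2 + 1)) +
          (l : ℝ) ^ 2 + (m : ℝ) ^ 2)) := by
  obtain ⟨T, hTc, hT4, hTα⟩ := exists_finset_sideOB hαl
  obtain ⟨U, hUc, hU4, hUα⟩ := exists_finset_sideAB hαm
  have hUne : U.Nonempty := Finset.card_pos.1 (by omega)
  have hαeq : α = sidePoints T U := by
    rw [sidePoints, hTα, hUα, ← Set.inter_union_distrib_left, Set.inter_eq_left.2 hα.1]
  have hcard := Set.encard_union_add_encard_inter (α ∩ sideOB) (α ∩ sideAB)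
  rw [← Set.inter_union_distrib_left, Set.inter_eq_left.2 hα.1, ← Set.inter_inter_distrib_left,
    hαl, hαm] at hcard
  have hB : pointAB 1 = pointOB 1 := by
    simp only [pointOB, pointAB]
    norm_num
  -- If `B` were in `α`, parameter 4 would lie in both `T` and `U`. Dropping it from `T` leaves the
  -- set unchanged and brings the count down to `l + m - 1 ≤ n`; rigidity then confines `U` to `[0,
  -- 2]`, which excludes 4.
  have hnot : pointOB 1 ∉ α := by
    intro hmem
    have h4T : (4 : ℝ) ∈ T := by
      have h : pointOB 1 ∈ α ∩ sideOB := ⟨hmem, pointOB_mem zero_le_one le_rfl⟩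
      rw [← hTα] at h
      obtain ⟨t, ht, h⟩ := h
      have h0 := congrArg (fun p : Plane => p 0) h
      simp [pointOB] at h0
      rwa [show (4 : ℝ) = t by linarith]
    have h4U : (4 : ℝ) ∈ U := by
      have h : pointOB 1 ∈ α ∩ sideAB := ⟨hmem, hB ▸ pointAB_mem le_rfl one_le_two⟩
      rw [← hUα] at h
      obtain ⟨t, ht, h⟩ := h
      have h0 := congrArg (fun p : Plane => p 0) h
      simp [pointOB, pointAB] at h0
      rwa [show (4 : ℝ) = t by linarith]
    have herase : sidePoints (T.erase 4) U = sidePoints T U := by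
      conv_rhs => rw [← Finset.insert_erase h4T]
      rw [sidePoints, sidePoints, Finset.coe_insert, Set.image_insert_eq, Set.insert_union,
        Set.insert_eq_of_mem]
      exact Or.inr ⟨4, h4U, by norm_num [hB]⟩
    have hTc' := Finset.card_erase_of_mem h4T
    have hTne : (T.erase 4).Nonempty := Finset.card_pos.1 (by omega)
    have hle : l + m ≤ n + 1 := by
      have h1 : (α ∩ (sideOB ∩ sideAB)).encard ≤ 1 :=
        (Set.encard_le_encard (Set.inter_subset_right.trans inter_sides_subset)).trans
          (Set.encard_singleton _).le
      have h2 := add_le_add hα.2.2.1 h1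
      rw [hcard] at h2
      exact_mod_cast h2
    obtain ⟨-, hmid, -⟩ := optimal_sidePoints hTne hUne
      (fun t ht => hT4 t (Finset.mem_of_mem_erase ht)) hU4 (by omega)
      (herase ▸ hαeq ▸ hα) rfl rfl
    have hp := sideCoeff_pos hTne.card_pos
    have hq := sideCoeff_pos hUne.card_pos
    have hd : 0 ≤ 2 * sideCoeff U.card / (sideCoeff (T.erase 4).card + sideCoeff U.card) := by
      positivity
    have hd' : 2 * sideCoeff U.card / (sideCoeff (T.erase 4).card + sideCoeff U.card) ≤ 2 := by
      rw [div_le_iff₀ (by positivity)]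
      linarith
    rw [hmid] at h4U
    have := midpoints_bounds (by linarith) h4U
    linarith
  have hTne : T.Nonempty := Finset.card_pos.1 (by omega)
  have hle : l + m ≤ n := by
    have h1 : α ∩ (sideOB ∩ sideAB) = ∅ := by
      rw [Set.eq_empty_iff_forall_notMem]
      rintro p ⟨hp, hp'⟩
      rw [Set.mem_singleton_iff.1 (inter_sides_subset hp')] at hp
      exact hnot hp
    rw [h1, Set.encard_empty, add_zero] at hcard
    have h2 := hα.2.2.1
    rw [hcard] at h2
    exact_mod_cast h2
  obtain ⟨hT, hU, hV⟩ := optimal_sidePoints hTne hUne hT4 hU4 (by omega) (hαeq ▸ hα) rfl rfl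
  rw [hTc, hUc] at hT hU hV
  have hl0 : (0 : ℝ) < l := by exact_mod_cast (by omega : 0 < l)
  have hm0 : (0 : ℝ) < m := by exact_mod_cast (by omega : 0 < m)
  have hP2 : √(12 * (l : ℝ) ^ 2 + 1) ^ 2 = 12 * (l : ℝ) ^ 2 + 1 := Real.sq_sqrt (by positivity)
  have hQ2 : √(12 * (m : ℝ) ^ 2 + 1) ^ 2 = 12 * (m : ℝ) ^ 2 + 1 := Real.sq_sqrt (by positivity)
  have h48 : √48 ^ 2 = (48 : ℝ) := Real.sq_sqrt (by positivity)
  have hP0 : 0 < √(12 * (l : ℝ) ^ 2 + 1) := Real.sqrt_pos.2 (by positivity)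
  have hQ0 : 0 < √(12 * (m : ℝ) ^ 2 + 1) := Real.sqrt_pos.2 (by positivity)
  have hr0 : 0 < √(48 : ℝ) := Real.sqrt_pos.2 (by positivity)
  rw [sideCoeff_eq, sideCoeff_eq] at hT hU hV
  rw [Real.sqrt_mul (by positivity)] at hu hv ⊢
  generalize √(12 * (l : ℝ) ^ 2 + 1) = P at *
  generalize √(12 * (m : ℝ) ^ 2 + 1) = Q at *
  generalize √(48 : ℝ) = r at *
  constructor
  · rw [hαeq, sidePoints, hT, hU, image_pointOB_midpoints, image_pointAB_midpoints]
    have hu' : 2 * (Q / (r * m)) / (P / (r * l) + Q / (r * m)) / (4 * l) = u := by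
      rw [hu, ← hP2]
      field_simp
      ring
    have hv' : (2 - 2 * (Q / (r * m)) / (P / (r * l) + Q / (r * m))) / (4 * m) = v := by
      rw [hv, ← hQ2]
      field_simp
      ring
    rw [hu', hv']
  · rw [hV]
    -- Since `P² = 12 l² + 1` and `Q² = 12 m² + 1`, the denominator is a perfect square, matching
    -- `(p + q)²` up to scaling.
    have hden : 24 * (l : ℝ) ^ 2 * (m : ℝ) ^ 2 + 2 * l * m * (P * Q) + (l : ℝ) ^ 2 + (m : ℝ) ^ 2 =
        (P * m + Q * l) ^ 2 := by
      linear_combination (-(m : ℝ) ^ 2) * hP2 - (l : ℝ) ^ 2 * hQ2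
    rw [hden, ← hP2, ← hQ2]
    field_simp
    rw [h48]
    ring
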